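/- Let $\mathbf{A}$ be an arbitrary commutative ring and let $A\in\mathbf{A}^{m\times n}$ be a matrix. Let $\mathbf{A}(t)$ be the localization $S^{-1}\mathbf{A}[t]$, where $S$ is the monoid of primitive polynomials (those whose coefficients generate the ideal $\langle 1\rangle$). Let $Q_n=\mathrm{diag}(1,t,\dots,t^{n-1})$, and let $A^{\circ}=Q_n^{-1}\,{}^{t}\!A\,Q_m\in\mathbf{A}(t)^{n\times m}$. A matrix $M$ over a commutative ring $\mathbf{B}$ is called *locally simple* over $\mathbf{B}$ if it has a generalized inverse, i.e. a matrix $N$ over $\mathbf{B}$ with $MNM=M$ and $NMN=N$. An $m\times n$ matrix over $\mathbf{B}$, seen as a linear map $\varphi:\mathbf{B}^n\to\mathbf{B}^m$, is called *quasi-simple* if there are bases $(e_1,\dots,e_n)$ of $\mathbf{B}^n$ and $(f_1,\dots,f_m)$ of $\mathbf{B}^m$ and idempotents $r_1,\dots,r_{\min(m,n)}$ of $\mathbf{B}$ with $r_ir_{i+1}=r_{i+1}$ for $1\le i<\min(m,n)$, such that $\varphi(e_i)=r_if_i$ for $i\le\min(m,n)$ and $\varphi(e_i)=0$ for $i>\min(m,n)$.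 Linear maps $\varphi:E\to F$ and $\psi:F\to E$ are called *crossed* if $F=\operatorname{Im}\varphi\oplus\operatorname{Ker}\psi$ and $E=\operatorname{Ker}\varphi\oplus\operatorname{Im}\psi$. The following properties are equivalent: 1. $A$ is locally simple over $\mathbf{A}$. 2. $A$ is locally simple over $\mathbf{A}(t)$. 3. $A$ is quasi-simple over $\mathbf{A}(t)$. 4. $A$ and $A^{\circ}$ are crossed over $\mathbf{A}(t)$. -/

import Mathlib

open Polynomial

namespace GenInv

/-- A matrix is locally simple if it has a generalized inverse. -/
def IsLocallySimple {R : Type*} [CommRing R] {m n : ℕ} (A : Matrix (Fin m) (Fin n) R) : Prop :=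
  ∃ B : Matrix (Fin n) (Fin m) R, A * B * A = A ∧ B * A * B = B

/-- The second equation comes for free: replace `B` by `B * A * B`. -/
theorem isLocallySimple_iff {R : Type*} [CommRing R] {m n : ℕ} (A : Matrix (Fin m) (Fin n) R) :
    IsLocallySimple A ↔ ∃ B : Matrix (Fin n) (Fin m) R, A * B * A = A := by
  refine ⟨fun ⟨B, h, _⟩ => ⟨B, h⟩, fun ⟨B, h⟩ => ⟨B * A * B, ?_, ?_⟩⟩
  · calc A * (B * A * B) * A = (A * B * A) * B * A := by simp only [Matrix.mul_assoc]
      _ = A := by rw [h, h]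
  · calc B * A * B * A * (B * A * B) = B * (A * B * A) * (B * A * B) := by
          simp only [Matrix.mul_assoc]
      _ = B * A * (B * A * B) := by rw [h]
      _ = B * (A * B * A) * B := by simp only [Matrix.mul_assoc]
      _ = B * A * B := by rw [h]

/-- A linear map `φ : E → F` between free modules of finite rank is quasi-simple if, for suitable
bases `e` of `E` (with `n` elements) and `f` of `F` (with `m` elements), `φ (e i) = r i • f i` for
`i < min n m` and `φ (e i) = 0` for the other `i`, where the `r i` are idempotents such that
`r i * r (i + 1) = r (i + 1)`. Indices start at `0`; only the `r i` with `i < min n m` matter. -/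
def IsQuasiSimple {R E F : Type*} [CommRing R] [AddCommGroup E] [Module R E]
    [AddCommGroup F] [Module R F] (φ : E →ₗ[R] F) : Prop :=
  ∃ (n m : ℕ) (e : Module.Basis (Fin n) R E) (f : Module.Basis (Fin m) R F) (r : ℕ → R),
    (∀ i, i < min n m → IsIdempotentElem (r i)) ∧
    (∀ i, i + 1 < min n m → r i * r (i + 1) = r (i + 1)) ∧
    (∀ (i : ℕ) (hn : i < n) (hm : i < m), φ (e ⟨i, hn⟩) = r i • f ⟨i, hm⟩) ∧
    (∀ i : Fin n, min n m ≤ (i : ℕ) → φ (e i) = 0)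

/-- Linear maps `φ : E → F` and `ψ : F → E` are crossed if `F = Im φ ⊕ Ker ψ` and
`E = Ker φ ⊕ Im ψ`. -/
def AreCrossed {R E F : Type*} [CommRing R] [AddCommGroup E] [Module R E]
    [AddCommGroup F] [Module R F] (φ : E →ₗ[R] F) (ψ : F →ₗ[R] E) : Prop :=
  IsCompl (LinearMap.range φ) (LinearMap.ker ψ) ∧ IsCompl (LinearMap.ker φ) (LinearMap.range ψ)

/-- The monoid of primitive polynomials: those whose coefficients generate the unit ideal. -/
def primitivePolynomials (R : Type*) [CommRing R] : Submonoid R[X] where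
  carrier := {p | p.contentIdeal = ⊤}
  one_mem' := contentIdeal_one
  mul_mem' := fun hp hq => contentIdeal_mul_eq_top_of_contentIdeal_eq_top hp hq

/-- The ring `R(t)`, localization of `R[t]` at the primitive polynomials. -/
abbrev NagataRing (R : Type*) [CommRing R] : Type _ := Localization (primitivePolynomials R)

/-- The indeterminate `t`, as an element of `R(t)`. -/
noncomputable def nagataT (R : Type*) [CommRing R] : NagataRing R :=
  algebraMap R[X] (NagataRing R) X

theorem isUnit_nagataT (R : Type*) [CommRing R] : IsUnit (nagataT R) :=
  IsLocalization.map_units (NagataRing R) (⟨X, by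
    change (X : R[X]).contentIdeal = ⊤
    rw [← monomial_one_one_eq_X, contentIdeal_monomial, Ideal.span_singleton_one]⟩ :
      primitivePolynomials R)

/-- The diagonal matrix with diagonal entries `1, t, …, t ^ (n - 1)`. -/
noncomputable def Q (R : Type*) [CommRing R] (n : ℕ) : Matrix (Fin n) (Fin n) (NagataRing R) :=
  Matrix.diagonal fun i => nagataT R ^ (i : ℕ)

/-- So the matrix inverse of `Q R n` is a true inverse. -/
theorem isUnit_det_Q (R : Type*) [CommRing R] (n : ℕ) : IsUnit (Q R n).det := by
  rw [Q, Matrix.det_diagonal, IsUnit.prod_univ_iff]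
  exact fun i => (isUnit_nagataT R).pow _

/-- The matrix `A`, seen as a matrix over `R(t)`. -/
noncomputable def extend {R : Type*} [CommRing R] {m n : ℕ} (A : Matrix (Fin m) (Fin n) R) :
    Matrix (Fin m) (Fin n) (NagataRing R) :=
  A.map (algebraMap R (NagataRing R))

/-- The matrix `A° = Qₙ⁻¹ Aᵀ Qₘ` over `R(t)`, adjoint of `A` for the quadratic forms with matrices
`Qₙ` and `Qₘ`. -/
noncomputable def circ {R : Type*} [CommRing R] {m n : ℕ} (A : Matrix (Fin m) (Fin n) R) :
    Matrix (Fin n) (Fin m) (NagataRing R) :=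
  (Q R n)⁻¹ * (extend A).transpose * Q R m

end GenInv

namespace GenInv

open Matrix

/-! The heart is 1 → 4. Over a domain, weighting the coordinates by distinct powers of `X` makes the
standard form nondegenerate on the image of any constant matrix
(`mulVec_eq_zero_of_transpose_mulVec`). If `A * B * A = A` and `N = polyAdjoint A`, it follows that
`1 - (A - A * N * A) * B` has nonzero determinant modulo every maximal ideal; so this determinant is
primitive, hence a unit of `R(t)`. Multiplying the matrix by `A` leaves `A * N * A`, so `A` is a
left multiple of `A * N * A`. The right-hand version and the transposes complete what
`areCrossed_toLin'` needs.

Conversely, 3 and 4 each give a generalized inverse over `R(t)`, and the linear system `A * B * A =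
A` descends to `R` by comparing coefficients.

Finally, 2 → 3 is Gaussian elimination. Pivots exist because a Kronecker substitution by powers of
`t` packs all entries into one polynomial (`hasUnitValues_nagataRing`). -/

/-! ### Nondegenerate forms and a primitive determinant. -/

theorem contentIdeal_eq_top_of_map_ne_zero {R : Type*} [CommRing R] {p : R[X]}
    (h : ∀ M : Ideal R, M.IsMaximal → p.map (Ideal.Quotient.mk M) ≠ 0) :
    p.contentIdeal = ⊤ := by
  by_contra hp
  obtain ⟨M, hM, hle⟩ := Ideal.exists_le_maximal _ hp
  refine h M hM (Polynomial.ext fun k => ?_)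
  rw [coeff_map, coeff_zero, Ideal.Quotient.eq_zero_iff_mem]
  exact hle (coeff_mem_contentIdeal p k)

/-- Over a domain, the form `∑ X ^ w i * x i * y i` with distinct exponents `w i` is nondegenerate
on every subspace that is defined by constants. -/
theorem mulVec_eq_zero_of_transpose_mulVec {K ι κ : Type*} [CommRing K] [IsDomain K]
    [Fintype ι] [Fintype κ] [DecidableEq ι] (M : Matrix ι κ K) {w : ι → ℕ}
    (hw : Function.Injective w) (z : κ → K[X])
    (h : (M.map C)ᵀ *ᵥ (diagonal (fun i => (X : K[X]) ^ w i) *ᵥ (M.map C *ᵥ z)) = 0) :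
    M.map C *ᵥ z = 0 := by
  classical
  set x := M.map C *ᵥ z with hx
  by_contra hne
  obtain ⟨i₁, hi₁⟩ := Function.ne_iff.mp hne
  obtain ⟨i₀, -, hi₀⟩ := Finset.exists_max_image Finset.univ (fun i => (x i).degree)
    ⟨i₁, Finset.mem_univ _⟩
  have hx₀ : x i₀ ≠ 0 := by
    intro h0
    have := hi₀ i₁ (Finset.mem_univ _)
    rw [h0, degree_zero, le_bot_iff, degree_eq_bot] at this
    exact hi₁ this
  set d := (x i₀).natDegree
  set c : ι → K := fun i => (x i).coeff d
  -- The top-degree part `c` of `x` is itself in the image of `M`, so it is orthogonal to `x` for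
  -- the weighted form.
  have hc : c = M *ᵥ (fun j => (z j).coeff d) := by
    ext i
    simp [c, hx, mulVec, dotProduct, finsetSum_coeff]
  have hdeg : ∀ i k, d < k → (x i).coeff k = 0 := fun i k hk =>
    coeff_eq_zero_of_degree_lt (lt_of_le_of_lt (hi₀ i (Finset.mem_univ _))
      (lt_of_le_of_lt degree_le_natDegree (by exact_mod_cast hk)))
  obtain ⟨p, hp, hpmax⟩ := Finset.exists_max_image (Finset.univ.filter fun i => c i ≠ 0) w
    ⟨i₀, by simpa [c, d] using hx₀⟩
  have hcp : c p ≠ 0 := (Finset.mem_filter.mp hp).2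
  have hsum : ∑ i, C (c i) * (X ^ w i * x i) = 0 := by
    have h1 : (fun i => C (c i)) = M.map C *ᵥ (fun j => C ((z j).coeff d)) := by
      ext1 i
      simp [hc, mulVec, dotProduct]
    have h2 : (fun i => C (c i)) ⬝ᵥ (diagonal (fun i => (X : K[X]) ^ w i) *ᵥ x) = 0 := by
      rw [h1, ← vecMul_transpose, ← dotProduct_mulVec, h, dotProduct_zero]
    simpa [dotProduct, mulVec_diagonal] using h2
  -- In this degree only `c p * c p` survives: any other `i` with `c i ≠ 0` has `w i < w p` and
  -- would need a coefficient of `x i` beyond degree `d`.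
  have h3 := congrArg (fun q => q.coeff (d + w p)) hsum
  simp only [finsetSum_coeff, coeff_C_mul, coeff_zero] at h3
  rw [Finset.sum_eq_single p] at h3
  · rw [coeff_X_pow_mul] at h3
    exact hcp (mul_self_eq_zero.mp h3)
  · intro i _ hip
    by_cases hci : c i = 0
    · rw [hci, zero_mul]
    · have hlt : w i < w p := lt_of_le_of_ne (hpmax i (by simp [hci])) (fun e => hip (hw e))
      rw [coeff_X_pow_mul', if_pos (by omega), hdeg i _ (by omega), mul_zero]
  · simp

/-- `X ^ (n - 1)` times the adjoint of `A`, as a matrix of polynomials. -/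
noncomputable def polyAdjoint {R : Type*} [CommRing R] {m n : ℕ} (A : Matrix (Fin m) (Fin n) R) :
    Matrix (Fin n) (Fin m) R[X] :=
  diagonal (fun j : Fin n => (X : R[X]) ^ (n - 1 - (j : ℕ))) * (A.map C)ᵀ *
    diagonal (fun i : Fin m => (X : R[X]) ^ (i : ℕ))

/-- A kernel vector `x` must lie in the image of `A` and be killed by `A * polyAdjoint A`.
Nondegeneracy, used for `Aᵀ` and then for `A`, forces `x = 0`. -/
theorem det_one_sub_add_ne_zero {K : Type*} [CommRing K] [IsDomain K] {m n : ℕ}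
    {A : Matrix (Fin m) (Fin n) K} {B : Matrix (Fin n) (Fin m) K} (h : A * B * A = A) :
    (1 - (A.map C - A.map C * polyAdjoint A * A.map C) * B.map C).det ≠ 0 := by
  intro hdet
  obtain ⟨x, hx0, hx⟩ := exists_mulVec_eq_zero_iff.mpr hdet
  have h' : A.map C * B.map C * A.map C = A.map (C : K →+* K[X]) := by
    rw [← Matrix.map_mul, ← Matrix.map_mul, h]
  set a := A.map (C : K →+* K[X])
  set b := B.map (C : K →+* K[X])
  have key : x - a *ᵥ b *ᵥ x + a *ᵥ polyAdjoint A *ᵥ a *ᵥ b *ᵥ x = 0 := by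
    rw [← hx]
    simp only [sub_mulVec, Matrix.sub_mul, one_mulVec, ← mulVec_mulVec]
    abel
  have hab : ∀ y, a *ᵥ b *ᵥ a *ᵥ y = a *ᵥ y := fun y => by
    rw [mulVec_mulVec, mulVec_mulVec, h']
  -- `a * b` fixes the image of `a`, so applying it to `key` cancels the first two terms.
  have h3 : a *ᵥ polyAdjoint A *ᵥ a *ᵥ b *ᵥ x = 0 := by
    have := congrArg (fun y => a *ᵥ b *ᵥ y) key
    simpa only [mulVec_add, mulVec_sub, hab, sub_self, zero_add, mulVec_zero] using this
  have h4 : x = a *ᵥ b *ᵥ x := by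
    rw [h3, add_zero, sub_eq_zero] at key
    exact key
  rw [← h4] at h3
  have h5 : aᵀ *ᵥ (diagonal (fun i : Fin m => (X : K[X]) ^ (i : ℕ)) *ᵥ x) = 0 := by
    refine mulVec_eq_zero_of_transpose_mulVec Aᵀ (w := fun j : Fin n => n - 1 - (j : ℕ))
      (fun i j hij => Fin.ext (by dsimp only at hij; omega)) _ ?_
    rw [← h3, polyAdjoint]
    simp only [← mulVec_mulVec]
    rfl
  apply hx0
  rw [h4]
  refine mulVec_eq_zero_of_transpose_mulVec A (w := fun i : Fin m => (i : ℕ))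
    Fin.val_injective _ ?_
  change aᵀ *ᵥ (diagonal (fun i : Fin m => (X : K[X]) ^ (i : ℕ)) *ᵥ (a *ᵥ b *ᵥ x)) = 0
  rw [← h4, h5]

theorem contentIdeal_det_eq_top {R : Type*} [CommRing R] {m n : ℕ}
    {A : Matrix (Fin m) (Fin n) R} {B : Matrix (Fin n) (Fin m) R} (h : A * B * A = A) :
    (1 - (A.map C - A.map C * polyAdjoint A * A.map C) * B.map C).det.contentIdeal = ⊤ := by
  refine contentIdeal_eq_top_of_map_ne_zero fun M hM => ?_
  have hM' := hM.isPrime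
  set f := Ideal.Quotient.mk M
  have hC : ∀ {p q : ℕ} (N : Matrix (Fin p) (Fin q) R),
      (N.map (C : R →+* R[X])).map (mapRingHom f) = (N.map f).map C := fun N => by
    ext1 i j; simp
  have hN : (polyAdjoint A).map (mapRingHom f) = polyAdjoint (A.map f) := by
    rw [polyAdjoint, polyAdjoint, Matrix.map_mul, Matrix.map_mul, diagonal_map (map_zero _),
      diagonal_map (map_zero _), ← transpose_map, hC]
    simp [Function.comp_def, transpose_map]
  have hAB : A.map f * B.map f * A.map f = A.map f := by
    rw [← Matrix.map_mul, ← Matrix.map_mul, h]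
  have := det_one_sub_add_ne_zero hAB
  rw [← hC, ← hC, ← hN, ← Matrix.map_mul, ← Matrix.map_mul,
    ← Matrix.map_sub _ (map_sub _), ← Matrix.map_mul,
    ← Matrix.map_one (mapRingHom f) (map_zero _) (map_one _),
    ← Matrix.map_sub _ (map_sub _)] at this
  rw [← coe_mapRingHom, RingHom.map_det]
  exact this

/-! ### Generalized inverses of linear maps, and descent from `R(t)` to `R`. -/

theorem IsLocallySimple.map {R S : Type*} [CommRing R] [CommRing S] (f : R →+* S) {m n : ℕ}
    {A : Matrix (Fin m) (Fin n) R} (h : IsLocallySimple A) : IsLocallySimple (A.map f) := by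
  obtain ⟨B, h₁, h₂⟩ := h
  exact ⟨B.map f, by rw [← Matrix.map_mul, ← Matrix.map_mul, h₁],
    by rw [← Matrix.map_mul, ← Matrix.map_mul, h₂]⟩

theorem isLocallySimple_iff_exists_linearMap {S : Type*} [CommRing S] {m n : ℕ}
    (A : Matrix (Fin m) (Fin n) S) :
    IsLocallySimple A ↔
      ∃ ψ : (Fin m → S) →ₗ[S] (Fin n → S), toLin' A ∘ₗ ψ ∘ₗ toLin' A = toLin' A := by
  rw [isLocallySimple_iff]
  constructor
  · rintro ⟨B, hB⟩
    refine ⟨toLin' B, ?_⟩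
    rw [← toLin'_mul, ← toLin'_mul, ← Matrix.mul_assoc, hB]
  · rintro ⟨ψ, hψ⟩
    refine ⟨LinearMap.toMatrix' ψ, toLin'.injective ?_⟩
    rw [toLin'_mul, toLin'_mul, toLin'_toMatrix', LinearMap.comp_assoc, hψ]

/-- The projection of `F` onto `Im φ` along `Ker ψ` lifts through `φ` because `F` is projective. -/
theorem AreCrossed.exists_comp_comp_eq {S E F : Type*} [CommRing S] [AddCommGroup E] [Module S E]
    [AddCommGroup F] [Module S F] [Module.Projective S F] {φ : E →ₗ[S] F} {ψ : F →ₗ[S] E}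
    (h : AreCrossed φ ψ) : ∃ χ : F →ₗ[S] E, φ ∘ₗ χ ∘ₗ φ = φ := by
  have hp := h.1
  obtain ⟨χ, hχ⟩ := Module.projective_lifting_property φ.rangeRestrict
    (Submodule.projectionOnto _ _ hp) φ.surjective_rangeRestrict
  refine ⟨χ, LinearMap.ext fun x => ?_⟩
  have := congrArg Subtype.val (LinearMap.congr_fun hχ (φ x))
  have h2 := Submodule.projectionOnto_apply_left hp ⟨φ x, ⟨x, rfl⟩⟩
  simp only [LinearMap.comp_apply] at this h2 ⊢
  rw [h2] at this
  simpa using this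

theorem IsQuasiSimple.exists_comp_comp_eq {S E F : Type*} [CommRing S] [AddCommGroup E]
    [Module S E] [AddCommGroup F] [Module S F] {φ : E →ₗ[S] F} (h : IsQuasiSimple φ) :
    ∃ χ : F →ₗ[S] E, φ ∘ₗ χ ∘ₗ φ = φ := by
  obtain ⟨n, m, e, f, r, hr, -, hφ, hφ0⟩ := h
  refine ⟨f.constr S fun j => if hj : (j : ℕ) < n then e ⟨j, hj⟩ else 0, e.ext fun i => ?_⟩
  simp only [LinearMap.comp_apply]
  by_cases hi : (i : ℕ) < m
  · have := hφ i i.2 hi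
    rw [Fin.eta] at this
    rw [this, map_smul, Module.Basis.constr_basis, dif_pos i.2, map_smul, Fin.eta, this, smul_smul,
      (hr i (by omega)).eq]
  · rw [hφ0 i (by omega), map_zero, map_zero]

/-- A matrix equation over `R` which has a solution over `R(t)` has one over `R`: compare the
coefficients of the numerators. -/
theorem isLocallySimple_of_extend {R : Type*} [CommRing R] {m n : ℕ}
    {A : Matrix (Fin m) (Fin n) R} (h : IsLocallySimple (extend A)) : IsLocallySimple A := by
  obtain ⟨B, hB, -⟩ := h
  obtain ⟨s, hs⟩ := IsLocalization.exist_integer_multiples_of_finite (primitivePolynomials R)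
    (fun ij : Fin n × Fin m => B ij.1 ij.2)
  choose p hp using hs
  set P : Matrix (Fin n) (Fin m) R[X] := Matrix.of fun i j => p (i, j) with hPdef
  set a := algebraMap R[X] (NagataRing R)
  have hext : extend A = (A.map C).map a := by
    ext i j
    simp only [extend, Matrix.map_apply, a]
    rw [IsScalarTower.algebraMap_apply R R[X] (NagataRing R), algebraMap_eq]
  have hP : P.map a = a s • B := by
    ext i j
    simp only [hPdef, Matrix.map_apply, of_apply, Matrix.smul_apply]
    exact (hp (i, j)).trans (Algebra.smul_def _ _)
  have h1 : (A.map C * P * A.map C).map a = ((s : R[X]) • A.map C).map a := by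
    rw [Matrix.map_mul, Matrix.map_mul, hP, ← hext, Matrix.mul_smul, Matrix.smul_mul, hB, hext]
    ext i j
    simp
  -- Equality in the localization holds up to a primitive factor for each entry; their product `d`
  -- serves all entries at once.
  have h2 : ∀ ij : Fin m × Fin n, ∃ c : primitivePolynomials R,
      (c : R[X]) * (A.map C * P * A.map C) ij.1 ij.2 = c * ((s : R[X]) • A.map C) ij.1 ij.2 :=
    fun ij => (IsLocalization.eq_iff_exists (primitivePolynomials R) (NagataRing R)).mp
      (congrFun (congrFun h1 ij.1) ij.2)
  choose c hc using h2
  set d : primitivePolynomials R := ∏ ij, c ij with hd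
  have h3 : A.map C * ((d : R[X]) • P) * A.map C = ((d * s : R[X])) • A.map C := by
    ext1 i j
    rw [Matrix.mul_smul, Matrix.smul_mul, mul_smul, Matrix.smul_apply, Matrix.smul_apply,
      smul_eq_mul, smul_eq_mul]
    obtain ⟨q, hq⟩ := Finset.dvd_prod_of_mem c (Finset.mem_univ (i, j))
    rw [← hd] at hq
    rw [hq, Submonoid.coe_mul, mul_comm (c (i, j) : R[X]), mul_assoc, mul_assoc, hc (i, j)]
  set P' := (d : R[X]) • P
  have h4 : ∀ k, A * P'.map (fun q => q.coeff k) * A = (d * s : R[X]).coeff k • A := fun k => by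
    ext i j
    have := congrArg (fun q => q.coeff k) (congrFun (congrFun h3 i) j)
    simp only [Matrix.smul_apply, smul_eq_mul, Matrix.map_apply, coeff_mul_C] at this
    rw [Matrix.smul_apply, smul_eq_mul, ← this]
    simp [Matrix.mul_apply, finsetSum_coeff]
  have h5 : (1 : R) ∈ (d * s : R[X]).contentIdeal := by
    rw [show (d * s : R[X]).contentIdeal = ⊤ from (d * s).2]
    trivial
  rw [isLocallySimple_iff]
  -- The scalars `x` for which `A * B * A = x • A` is solvable form an ideal; it contains every
  -- coefficient of `d * s`, hence `1`.
  have h6 : ∀ x ∈ (d * s : R[X]).contentIdeal,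
      ∃ B : Matrix (Fin n) (Fin m) R, A * B * A = x • A := by
    intro x hx
    induction hx using Submodule.span_induction with
    | mem x hx =>
      obtain ⟨k, -, rfl⟩ := mem_coeffs_iff.mp hx
      exact ⟨_, h4 k⟩
    | zero => exact ⟨0, by simp⟩
    | add x y _ _ hx hy =>
      obtain ⟨B, hB⟩ := hx
      obtain ⟨B', hB'⟩ := hy
      exact ⟨B + B', by rw [Matrix.mul_add, Matrix.add_mul, hB, hB', add_smul]⟩
    | smul c x _ hx =>
      obtain ⟨B, hB⟩ := hx
      exact ⟨c • B, by rw [Matrix.mul_smul, Matrix.smul_mul, hB, smul_smul, smul_eq_mul]⟩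
  obtain ⟨B, hB⟩ := h6 1 h5
  exact ⟨B, by rw [hB, one_smul]⟩

/-! ### Crossedness of `A` and its adjoint. -/

/-- `h₁` gives `Im A ∩ Ker N = 0`, and `h₄` splits `x` with `A N C₄ x` as its component in `Im A`.
The other decomposition follows by exchanging `A` and `N`. -/
theorem areCrossed_toLin' {S : Type*} [CommRing S] {m n : ℕ}
    {A : Matrix (Fin m) (Fin n) S} {N : Matrix (Fin n) (Fin m) S}
    {C₁ : Matrix (Fin m) (Fin m) S} {C₂ : Matrix (Fin n) (Fin n) S}
    {C₃ : Matrix (Fin n) (Fin n) S} {C₄ : Matrix (Fin m) (Fin m) S}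
    (h₁ : A = C₁ * (A * N * A)) (h₂ : A = A * N * A * C₂)
    (h₃ : N = C₃ * (N * A * N)) (h₄ : N = N * A * N * C₄) :
    AreCrossed (toLin' A) (toLin' N) := by
  have key : ∀ {p q : ℕ} {A : Matrix (Fin p) (Fin q) S} {N : Matrix (Fin q) (Fin p) S}
      {C₁ : Matrix (Fin p) (Fin p) S} {C₄ : Matrix (Fin p) (Fin p) S},
      A = C₁ * (A * N * A) → N = N * A * N * C₄ →
      IsCompl (LinearMap.range (toLin' A)) (LinearMap.ker (toLin' N)) := by
    intro p q A N C₁ C₄ h₁ h₄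
    constructor
    · rw [Submodule.disjoint_def]
      rintro _ ⟨y, rfl⟩ hy
      simp only [LinearMap.mem_ker, toLin'_apply] at hy ⊢
      rw [h₁]
      simp only [← mulVec_mulVec, hy, mulVec_zero]
    · rw [codisjoint_iff, eq_top_iff]
      intro x _
      rw [Submodule.mem_sup]
      refine ⟨A *ᵥ N *ᵥ C₄ *ᵥ x, ⟨N *ᵥ C₄ *ᵥ x, rfl⟩, x - A *ᵥ N *ᵥ C₄ *ᵥ x, ?_, by simp⟩
      rw [LinearMap.mem_ker, toLin'_apply, mulVec_sub, sub_eq_zero]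
      conv_lhs => rw [h₄]
      simp only [← mulVec_mulVec]
  exact ⟨key h₁ h₄, (key h₃ h₂).symm⟩

theorem areCrossed_of_isLocallySimple {R : Type*} [CommRing R] {m n : ℕ}
    {A : Matrix (Fin m) (Fin n) R} (h : IsLocallySimple A) :
    AreCrossed (toLin' (extend A)) (toLin' (circ A)) := by
  obtain ⟨B, hB, -⟩ := h
  set a := algebraMap R[X] (NagataRing R) with ha
  have hext : ∀ {p q : ℕ} (M : Matrix (Fin p) (Fin q) R),
      (M.map C).map a = M.map (algebraMap R (NagataRing R)) := by
    intro p q M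
    ext i j
    simp only [Matrix.map_apply, a]
    rw [IsScalarTower.algebraMap_apply R R[X] (NagataRing R), algebraMap_eq]
  have hQn := isUnit_det_Q R n
  have hQm := isUnit_det_Q R m
  have hN : (polyAdjoint A).map a = nagataT R ^ (n - 1) • circ A := by
    have hW : diagonal (fun j : Fin n => nagataT R ^ (n - 1 - (j : ℕ))) =
        nagataT R ^ (n - 1) • (Q R n)⁻¹ := by
      have : diagonal (fun j : Fin n => nagataT R ^ (n - 1 - (j : ℕ))) * Q R n =
          nagataT R ^ (n - 1) • 1 := by
        rw [Q, diagonal_mul_diagonal, smul_one_eq_diagonal]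
        congr 1
        ext1 j
        rw [← pow_add]
        congr 1
        omega
      rw [← mul_nonsing_inv_cancel_right (Q R n) (diagonal _) hQn, this, Matrix.smul_mul,
        Matrix.one_mul]
    rw [polyAdjoint, Matrix.map_mul, Matrix.map_mul, diagonal_map (map_zero _),
      diagonal_map (map_zero _), ← transpose_map, hext, circ, ← Matrix.smul_mul,
      ← Matrix.smul_mul, ← hW]
    simp only [map_pow]
    rfl
  have hB' : extend A * extend B * extend A = extend A := by
    rw [extend, extend, ← Matrix.map_mul, ← Matrix.map_mul, hB]
  set E := extend A
  set G := extend B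
  set T := nagataT R ^ (n - 1)
  set N := circ A with hNdef
  have hdet : IsUnit (1 - (E - E * (T • N) * E) * G).det := by
    have := IsLocalization.map_units (NagataRing R)
      (⟨_, contentIdeal_det_eq_top hB⟩ : primitivePolynomials R)
    rw [RingHom.map_det] at this
    change IsUnit (Matrix.map _ a).det at this
    rw [Matrix.map_sub _ (map_sub _), Matrix.map_mul, Matrix.map_sub _ (map_sub _),
      Matrix.map_mul, Matrix.map_mul, hext, hext, Matrix.map_one _ (map_zero _) (map_one _),
      hN] at this
    exact this
  -- Sylvester's identity moves the unit determinant to the other side, for use on the right of `E`.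
  have hdet' : IsUnit (1 - G * (E - E * (T • N) * E)).det := by rwa [← det_one_sub_mul_comm]
  have h₁ : E = (T • (1 - (E - E * (T • N) * E) * G)⁻¹) * (E * N * E) := by
    have : (1 - (E - E * (T • N) * E) * G) * E = T • (E * N * E) := by
      rw [Matrix.sub_mul, Matrix.one_mul, Matrix.sub_mul, Matrix.sub_mul, hB',
        Matrix.mul_assoc _ E G, Matrix.mul_assoc _ (E * G) E, hB']
      simp
    rw [Matrix.smul_mul, ← Matrix.mul_smul, ← this, nonsing_inv_mul_cancel_left _ _ hdet]
  have h₂ : E = (E * N * E) * (T • (1 - G * (E - E * (T • N) * E))⁻¹) := by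
    have : E * (1 - G * (E - E * (T • N) * E)) = T • (E * N * E) := by
      rw [Matrix.mul_sub, Matrix.mul_one, Matrix.mul_sub, Matrix.mul_sub, ← Matrix.mul_assoc, hB',
        ← Matrix.mul_assoc, ← Matrix.mul_assoc, ← Matrix.mul_assoc, hB']
      simp
    rw [Matrix.mul_smul, ← Matrix.smul_mul, ← this, mul_nonsing_inv_cancel_right _ _ hdet']
  have hNt : N = (Q R n)⁻¹ * Eᵀ * Q R m := rfl
  have hQt : ∀ k, (Q R k)ᵀ = Q R k := fun k => diagonal_transpose _
  have hNT : Nᵀ = Q R m * E * (Q R n)⁻¹ := by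
    rw [hNt, transpose_mul, transpose_mul, transpose_nonsing_inv, hQt, hQt, transpose_transpose,
      Matrix.mul_assoc]
  -- Transposition exchanges `E` and `N` up to the invertible `Q`'s, so `h₂` yields `h₃` and `h₁`
  -- yields `h₄`.
  have hT : (E * N * E)ᵀ = Q R n * (N * E * N) * (Q R m)⁻¹ := by
    rw [transpose_mul, transpose_mul, hNT, hNt]
    simp only [Matrix.mul_assoc]
    rw [mul_nonsing_inv_cancel_left _ _ hQn, mul_nonsing_inv _ hQm, Matrix.mul_one]
  have h₃ : N = ((Q R n)⁻¹ * (T • (1 - G * (E - E * (T • N) * E))⁻¹)ᵀ * Q R n) *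
      (N * E * N) := by
    conv_lhs => rw [hNt, h₂, transpose_mul, hT]
    simp only [Matrix.mul_assoc]
    rw [nonsing_inv_mul _ hQm, Matrix.mul_one]
  have h₄ : N = (N * E * N) *
      ((Q R m)⁻¹ * (T • (1 - (E - E * (T • N) * E) * G)⁻¹)ᵀ * Q R m) := by
    conv_lhs => rw [hNt, h₁, transpose_mul, hT]
    simp only [Matrix.mul_assoc]
    rw [nonsing_inv_mul_cancel_left _ _ hQn]
  exact areCrossed_toLin' h₁ h₂ h₃ h₄

/-! ### Unit values by Kronecker substitution. -/

/-- Every matrix whose entries generate the unit ideal takes a unit value on some pair of vectors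
with first entries `1`. -/
def HasUnitValues (S : Type*) [CommRing S] : Prop :=
  ∀ ⦃m n : ℕ⦄ (A : Matrix (Fin (m + 1)) (Fin (n + 1)) S),
    Ideal.span (Set.range fun ij : Fin (m + 1) × Fin (n + 1) => A ij.1 ij.2) = ⊤ →
    ∃ (u : Fin (m + 1) → S) (v : Fin (n + 1) → S), u 0 = 1 ∧ v 0 = 1 ∧ IsUnit (u ⬝ᵥ A *ᵥ v)

theorem hasUnitValues_nagataRing (R : Type*) [CommRing R] : HasUnitValues (NagataRing R) := by
  intro m n A hA
  obtain ⟨s, hs⟩ := IsLocalization.exist_integer_multiples_of_finite (primitivePolynomials R)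
    (fun ij : Fin (m + 1) × Fin (n + 1) => A ij.1 ij.2)
  choose p hp using hs
  set a := algebraMap R[X] (NagataRing R) with ha
  replace hp : ∀ i j, a (p (i, j)) = a s * A i j := fun i j =>
    (hp (i, j)).trans (Algebra.smul_def _ _)
  have hsu : IsUnit (a s) := IsLocalization.map_units (NagataRing R) s
  set N := (Finset.univ.sup fun ij => (p ij).natDegree) + 1
  have hN : ∀ ij, (p ij).natDegree < N := fun ij =>
    Nat.lt_succ_of_le (Finset.le_sup (f := fun ij => (p ij).natDegree) (Finset.mem_univ ij))
  -- Since `N` exceeds all degrees, the shifted numerators occupy disjoint slots of length `N` in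
  -- `q`. The exponent is a sum of a row part and a column part, so `q` is a bilinear value.
  set w : Fin (m + 1) × Fin (n + 1) → ℕ := fun ij => N * ((ij.1 : ℕ) + (m + 1) * (ij.2 : ℕ))
    with hw
  set q : R[X] := ∑ ij, X ^ w ij * p ij with hq
  have hcoeff : ∀ ij, ∀ k < N, q.coeff (w ij + k) = (p ij).coeff k := by
    intro ij k hk
    rw [hq, finsetSum_coeff, Finset.sum_eq_single ij]
    · rw [add_comm, coeff_X_pow_mul]
    · intro ij' _ hne
      rw [coeff_X_pow_mul']
      split_ifs with hle
      · refine coeff_eq_zero_of_natDegree_lt ((hN ij').trans_le ?_)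
        set x := (ij.1 : ℕ) + (m + 1) * (ij.2 : ℕ) with hx
        set x' := (ij'.1 : ℕ) + (m + 1) * (ij'.2 : ℕ) with hx'
        have hxx : x ≠ x' := by
          intro h
          apply hne
          have h1 : x % (m + 1) = x' % (m + 1) := by rw [h]
          have h2 : x / (m + 1) = x' / (m + 1) := by rw [h]
          rw [hx, hx', Nat.add_mul_mod_self_left, Nat.add_mul_mod_self_left,
            Nat.mod_eq_of_lt ij.1.2, Nat.mod_eq_of_lt ij'.1.2] at h1
          rw [hx, hx', Nat.add_mul_div_left _ _ m.succ_pos, Nat.add_mul_div_left _ _ m.succ_pos,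
            Nat.div_eq_of_lt ij.1.2, Nat.div_eq_of_lt ij'.1.2, zero_add, zero_add] at h2
          exact Prod.ext (Fin.ext h1.symm) (Fin.ext h2.symm)
        change N * x' ≤ N * x + k at hle
        change N ≤ N * x + k - N * x'
        have hlt : x' < x := by
          by_contra hge
          have : N * (x + 1) ≤ N * x' := Nat.mul_le_mul_left _ (by omega)
          rw [Nat.mul_succ] at this
          omega
        have : N * (x' + 1) ≤ N * x := Nat.mul_le_mul_left _ hlt
        rw [Nat.mul_succ] at this
        omega
      · rfl
    · simp
  have hprim : q.contentIdeal = ⊤ := by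
    refine contentIdeal_eq_top_of_map_ne_zero fun M hM hq0 => ?_
    have hM' := hM.isPrime
    set f := Ideal.Quotient.mk M
    have hpM : ∀ ij, (p ij).map f = 0 := by
      intro ij
      ext k
      rw [coeff_map, coeff_zero]
      by_cases hk : k < N
      · rw [← hcoeff ij k hk, ← coeff_map, hq0, coeff_zero]
      · rw [coeff_eq_zero_of_natDegree_lt ((hN ij).trans_le (not_lt.mp hk)), map_zero]
    -- Primitive polynomials stay nonzero modulo `M`, so `R(t)` maps to this field. If all
    -- numerators vanished there, so would the entries of `A`, which generate the unit ideal.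
    set g : R[X] →+* FractionRing (R ⧸ M)[X] :=
      (algebraMap (R ⧸ M)[X] (FractionRing (R ⧸ M)[X])).comp (mapRingHom f) with hg
    have hgu : ∀ y : primitivePolynomials R, IsUnit (g y) := by
      rintro ⟨y, hy⟩
      rw [isUnit_iff_ne_zero]
      simp only [hg, RingHom.comp_apply, ne_eq, FaithfulSMul.algebraMap_eq_zero_iff]
      intro hy0
      have hle : y.contentIdeal ≤ M := Ideal.span_le.mpr fun c hc => by
        obtain ⟨k, -, rfl⟩ := mem_coeffs_iff.mp hc
        have := congrArg (fun r => r.coeff k) hy0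
        rw [coe_mapRingHom] at this
        simp only [coeff_map, coeff_zero] at this
        exact Ideal.Quotient.eq_zero_iff_mem.mp this
      rw [show y.contentIdeal = ⊤ from hy] at hle
      exact hM.ne_top (top_le_iff.mp hle)
    set l : NagataRing R →+* FractionRing (R ⧸ M)[X] := IsLocalization.lift hgu with hl
    have hker : (⊤ : Ideal (NagataRing R)) ≤ RingHom.ker l := by
      rw [← hA, Ideal.span_le]
      rintro _ ⟨⟨i, j⟩, rfl⟩
      have h1 := congrArg l (hp i j)
      rw [map_mul, hl, ha, IsLocalization.lift_eq, IsLocalization.lift_eq] at h1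
      rw [show g (p (i, j)) = 0 by
        rw [hg, RingHom.comp_apply, coe_mapRingHom, hpM, map_zero]] at h1
      exact (mul_eq_zero.mp h1.symm).resolve_left (hgu s).ne_zero
    have := hker (Submodule.mem_top : (1 : NagataRing R) ∈ ⊤)
    rw [RingHom.mem_ker, map_one] at this
    exact one_ne_zero this
  have hqu : IsUnit (a q) :=
    IsLocalization.map_units (NagataRing R) (⟨q, hprim⟩ : primitivePolynomials R)
  refine ⟨fun i => a X ^ (N * (i : ℕ)), fun j => a X ^ (N * ((m + 1) * (j : ℕ))), by simp, by simp,
    ?_⟩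
  refine isUnit_of_mul_isUnit_right (x := a s) ?_
  convert hqu using 1
  rw [hq, map_sum, Fintype.sum_prod_type]
  simp only [dotProduct, mulVec, Finset.mul_sum, map_mul, hp, hw, mul_add, pow_add, map_pow]
  refine Finset.sum_congr rfl fun i _ => Finset.sum_congr rfl fun j _ => ?_
  ring

/-! ### Diagonalization with idempotent pivots. -/

section Diagonalization

variable {S : Type*} [CommRing S] {m n : ℕ}

/-- The block diagonal matrix with blocks `r` and `A`. -/
def consBlock (r : S) (A : Matrix (Fin m) (Fin n) S) : Matrix (Fin (m + 1)) (Fin (n + 1)) S :=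
  Matrix.of (Fin.cons (Fin.cons r 0) fun i => Fin.cons 0 (A i))

@[simp] theorem consBlock_zero_zero (r : S) (A : Matrix (Fin m) (Fin n) S) :
    consBlock r A 0 0 = r := rfl

@[simp] theorem consBlock_zero_succ (r : S) (A : Matrix (Fin m) (Fin n) S) (j : Fin n) :
    consBlock r A 0 j.succ = 0 := rfl

@[simp] theorem consBlock_succ_zero (r : S) (A : Matrix (Fin m) (Fin n) S) (i : Fin m) :
    consBlock r A i.succ 0 = 0 := rfl

@[simp] theorem consBlock_succ_succ (r : S) (A : Matrix (Fin m) (Fin n) S) (i : Fin m)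
    (j : Fin n) : consBlock r A i.succ j.succ = A i j := rfl

theorem consBlock_mul_consBlock {k : ℕ} (r s : S) (A : Matrix (Fin m) (Fin n) S)
    (B : Matrix (Fin n) (Fin k) S) :
    consBlock r A * consBlock s B = consBlock (r * s) (A * B) := by
  ext i j
  refine Fin.cases ?_ (fun i => ?_) i <;> refine Fin.cases ?_ (fun j => ?_) j <;>
    simp [Matrix.mul_apply, Fin.sum_univ_succ]

theorem consBlock_one_one : consBlock (1 : S) (1 : Matrix (Fin m) (Fin m) S) = 1 := by
  ext i j
  refine Fin.cases ?_ (fun i => ?_) i <;> refine Fin.cases ?_ (fun j => ?_) j <;>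
    simp [Matrix.one_apply, Fin.succ_ne_zero, (Fin.succ_ne_zero _).symm]

theorem isUnit_consBlock {U : Matrix (Fin m) (Fin m) S} (hU : IsUnit U) :
    IsUnit (consBlock 1 U) := by
  obtain ⟨V, h₁, h₂⟩ := isUnit_iff_exists.mp hU
  exact isUnit_iff_exists.mpr ⟨consBlock 1 V,
    by rw [consBlock_mul_consBlock, h₁, one_mul, consBlock_one_one],
    by rw [consBlock_mul_consBlock, h₂, one_mul, consBlock_one_one]⟩

theorem isUnit_one_updateRow {u : Fin (m + 1) → S} (hu : IsUnit (u 0)) :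
    IsUnit ((1 : Matrix (Fin (m + 1)) (Fin (m + 1)) S).updateRow 0 u) := by
  have : u = ∑ k, u k • (1 : Matrix (Fin (m + 1)) (Fin (m + 1)) S) k := by
    ext j
    simp [Matrix.one_apply]
  have hdet := det_updateRow_sum (1 : Matrix (Fin (m + 1)) (Fin (m + 1)) S) 0 u
  rw [← this, det_one, smul_eq_mul, mul_one] at hdet
  rwa [Matrix.isUnit_iff_isUnit_det, hdet]

theorem isLocallySimple_mul_mul {A : Matrix (Fin m) (Fin n) S} (hA : IsLocallySimple A)
    {U : Matrix (Fin m) (Fin m) S} {V : Matrix (Fin n) (Fin n) S} (hU : IsUnit U)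
    (hV : IsUnit V) : IsLocallySimple (U * A * V) := by
  obtain ⟨B, hB, -⟩ := hA
  obtain ⟨U', -, hU'⟩ := isUnit_iff_exists.mp hU
  obtain ⟨V', hV', -⟩ := isUnit_iff_exists.mp hV
  refine (isLocallySimple_iff _).mpr ⟨V' * B * U', ?_⟩
  calc U * A * V * (V' * B * U') * (U * A * V)
      = U * A * (V * V') * B * (U' * U) * A * V := by simp only [Matrix.mul_assoc]
    _ = U * (A * B * A) * V := by rw [hU', hV']; simp only [Matrix.mul_assoc, Matrix.one_mul]
    _ = U * A * V := by rw [hB]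

theorem isLocallySimple_of_consBlock {r : S} {A : Matrix (Fin m) (Fin n) S}
    (h : IsLocallySimple (consBlock r A)) : IsLocallySimple A := by
  obtain ⟨B, hB, -⟩ := h
  refine (isLocallySimple_iff _).mpr ⟨B.submatrix Fin.succ Fin.succ, ?_⟩
  ext i j
  have := congrFun (congrFun hB i.succ) j.succ
  simpa [Matrix.mul_apply, Fin.sum_univ_succ] using this

/-- The ideal generated by the entries of a locally simple matrix is generated by an idempotent. -/
theorem IsLocallySimple.exists_isIdempotentElem {A : Matrix (Fin m) (Fin n) S}
    (h : IsLocallySimple A) : ∃ r : S, IsIdempotentElem r ∧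
      Ideal.span (Set.range fun ij : Fin m × Fin n => A ij.1 ij.2) = Ideal.span {r} := by
  obtain ⟨B, hB, -⟩ := h
  set I := Ideal.span (Set.range fun ij : Fin m × Fin n => A ij.1 ij.2)
  have hmem : ∀ i j, A i j ∈ I := fun i j => Ideal.subset_span ⟨(i, j), rfl⟩
  refine (Ideal.isIdempotentElem_iff_of_fg I (Submodule.fg_span (Set.finite_range _))).mp ?_
  refine le_antisymm Ideal.mul_le_right (Ideal.span_le.mpr ?_)
  rintro _ ⟨⟨i, j⟩, rfl⟩
  change A i j ∈ I * I
  rw [← hB, Matrix.mul_apply]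
  refine Ideal.sum_mem _ fun k _ => Ideal.mul_mem_mul ?_ (hmem k j)
  rw [Matrix.mul_apply]
  exact Ideal.sum_mem _ fun l _ => Ideal.mul_mem_right _ _ (hmem i l)

theorem HasUnitValues.exists_pivot (hS : HasUnitValues S)
    {A : Matrix (Fin (m + 1)) (Fin (n + 1)) S} {r : S} (hr : IsIdempotentElem r)
    (hA : Ideal.span (Set.range fun ij : Fin (m + 1) × Fin (n + 1) => A ij.1 ij.2) =
      Ideal.span {r}) (hrA : r • A = A) :
    ∃ (U : Matrix (Fin (m + 1)) (Fin (m + 1)) S) (V : Matrix (Fin (n + 1)) (Fin (n + 1)) S),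
      IsUnit U ∧ IsUnit V ∧ (U * A * V) 0 0 = r := by
  -- Adding `1 - r` in the corner makes the entries generate the unit ideal. As `u 0 = v 0 = 1`, it
  -- contributes exactly `1 - r` to the unit value, which `r` kills.
  set D : Matrix (Fin (m + 1)) (Fin (n + 1)) S := Matrix.single 0 0 (1 - r) with hD
  have hr' : r * (1 - r) = 0 := by rw [mul_sub, mul_one, hr.eq, sub_self]
  obtain ⟨u, v, hu, hv, ω, hω⟩ := hS (A + D) (by
    set J := Ideal.span
      (Set.range fun ij : Fin (m + 1) × Fin (n + 1) => (A + D) ij.1 ij.2) with hJ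
    have hmem : ∀ i j, (A + D) i j ∈ J := fun i j => Ideal.subset_span ⟨(i, j), rfl⟩
    have hAJ : ∀ i j, A i j ∈ J := fun i j => by
      have h1 : r • (A + D) = A := by
        rw [smul_add, hrA, hD, smul_single, smul_eq_mul, hr', single_zero, add_zero]
      rw [← congrFun (congrFun h1 i) j]
      exact J.mul_mem_left r (hmem i j)
    have h1 : r ∈ J := by
      have : Ideal.span {r} ≤ J := by
        rw [← hA, Ideal.span_le]
        rintro _ ⟨⟨i, j⟩, rfl⟩
        exact hAJ i j
      exact this (Ideal.mem_span_singleton_self r)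
    have h2 : 1 - r ∈ J := by
      have := J.sub_mem (hmem 0 0) (hAJ 0 0)
      simpa [hD] using this
    rw [Ideal.eq_top_iff_one]
    simpa using J.add_mem h1 h2)
  have hα : u ⬝ᵥ A *ᵥ v = r * ω := by
    have h1 : u ⬝ᵥ A *ᵥ v = r * (u ⬝ᵥ A *ᵥ v) := by
      conv_lhs => rw [← hrA, smul_mulVec, dotProduct_smul, smul_eq_mul]
    have h2 : u ⬝ᵥ D *ᵥ v = 1 - r := by
      simp [hD, single_mulVec, dotProduct, Function.update_apply, hu, hv]
    rw [hω, add_mulVec, dotProduct_add, h2, mul_add, hr', add_zero, ← h1]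
  refine ⟨(1 : Matrix (Fin (m + 1)) (Fin (m + 1)) S).updateRow 0 ((↑ω⁻¹ : S) • u),
    ((1 : Matrix (Fin (n + 1)) (Fin (n + 1)) S).updateRow 0 v)ᵀ, isUnit_one_updateRow ?_, ?_, ?_⟩
  · simp [hu]
  · rw [isUnit_transpose]
    exact isUnit_one_updateRow (by simp [hv])
  · have h1 : (((1 : Matrix (Fin (m + 1)) (Fin (m + 1)) S).updateRow 0 ((↑ω⁻¹ : S) • u)) *
        A * ((1 : Matrix (Fin (n + 1)) (Fin (n + 1)) S).updateRow 0 v)ᵀ) 0 0 =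
        ((↑ω⁻¹ : S) • u) ⬝ᵥ A *ᵥ v := by
      rw [dotProduct_mulVec]
      simp [Matrix.mul_apply, vecMul, dotProduct]
    rw [h1, smul_dotProduct, hα, smul_eq_mul, mul_comm r, Units.inv_mul_cancel_left]

/-- The pivot acts as `1` on every entry, so its row and column are cleared without division. -/
theorem exists_mul_mul_eq_consBlock {A : Matrix (Fin (m + 1)) (Fin (n + 1)) S}
    (hA : A 0 0 • A = A) :
    ∃ (U : Matrix (Fin (m + 1)) (Fin (m + 1)) S) (V : Matrix (Fin (n + 1)) (Fin (n + 1)) S)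
      (A' : Matrix (Fin m) (Fin n) S), IsUnit U ∧ IsUnit V ∧
      U * A * V = consBlock (A 0 0) A' := by
  have hA' : ∀ i j, A 0 0 * A i j = A i j := fun i j => congrFun (congrFun hA i) j
  set c : Fin (m + 1) → S := Fin.cons 1 fun i => -A i.succ 0 with hc
  set d : Fin (n + 1) → S := Fin.cons 1 fun j => -A 0 j.succ with hd
  set U : Matrix (Fin (m + 1)) (Fin (m + 1)) S := ((1 : Matrix _ _ S).updateRow 0 c)ᵀ with hU
  set V : Matrix (Fin (n + 1)) (Fin (n + 1)) S := (1 : Matrix _ _ S).updateRow 0 d with hV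
  have hU0 : ∀ j, (U * A) 0 j = A 0 j := fun j => by
    simp [hU, hc, Matrix.mul_apply, Fin.sum_univ_succ, Fin.succ_ne_zero]
  have hU1 : ∀ i, (U * A) (Fin.succ i) 0 = 0 := fun i => by
    have := hA' i.succ 0
    simp [hU, hc, Matrix.mul_apply, Fin.sum_univ_succ, Matrix.one_apply, Fin.succ_ne_zero]
    rw [mul_comm, this, neg_add_cancel]
  have hV0 : ∀ i, (U * A * V) i 0 = (U * A) i 0 := fun i => by
    rw [Matrix.mul_apply, Fin.sum_univ_succ]
    simp [hV, hd, Fin.succ_ne_zero]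
  have hV1 : ∀ j, (U * A * V) 0 (Fin.succ j) = 0 := fun j => by
    rw [Matrix.mul_apply, Fin.sum_univ_succ]
    simp only [hU0]
    simp [hV, hd, Matrix.one_apply, Fin.succ_ne_zero, hA']
  refine ⟨U, V, (U * A * V).submatrix Fin.succ Fin.succ, ?_, isUnit_one_updateRow (by simp [hd]),
    ?_⟩
  · rw [hU, isUnit_transpose]
    exact isUnit_one_updateRow (by simp [hc])
  · ext i j
    refine Fin.cases ?_ (fun i => ?_) i <;> refine Fin.cases ?_ (fun j => ?_) j
    · rw [hV0, hU0, consBlock_zero_zero]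
    · rw [hV1, consBlock_zero_succ]
    · rw [hV0, hU1, consBlock_succ_zero]
    · rfl

/-- The rectangular matrix with diagonal entries `r i`. -/
def rectDiagonal (m n : ℕ) (r : ℕ → S) : Matrix (Fin m) (Fin n) S :=
  Matrix.of fun i j => if (i : ℕ) = j then r i else 0

/-- The clause on scalars `s` strengthens the induction: the pivot `r` fixes the remaining block,
hence all later idempotents, which gives the divisibility chain. -/
theorem HasUnitValues.exists_diagonal (hS : HasUnitValues S) :
    ∀ {m n : ℕ} {A : Matrix (Fin m) (Fin n) S}, IsLocallySimple A →
    ∃ (U : Matrix (Fin m) (Fin m) S) (V : Matrix (Fin n) (Fin n) S) (r : ℕ → S),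
      IsUnit U ∧ IsUnit V ∧ (∀ i, IsIdempotentElem (r i)) ∧ (∀ i, r i * r (i + 1) = r (i + 1)) ∧
      (∀ s : S, s • A = A → ∀ i, s * r i = r i) ∧ U * A * V = rectDiagonal m n r
  | 0, n, A, _ => ⟨1, 1, 0, isUnit_one, isUnit_one, fun _ => .zero, by simp, by simp,
      Matrix.ext fun i => i.elim0⟩
  | m + 1, 0, A, _ => ⟨1, 1, 0, isUnit_one, isUnit_one, fun _ => .zero, by simp, by simp,
      Matrix.ext fun _ j => j.elim0⟩
  | m + 1, n + 1, A, hA => by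
    obtain ⟨r, hr, hrA⟩ := hA.exists_isIdempotentElem
    have hrA' : r • A = A := by
      ext i j
      have : A i j ∈ Ideal.span {r} := hrA ▸ Ideal.subset_span ⟨(i, j), rfl⟩
      obtain ⟨c, hc⟩ := Ideal.mem_span_singleton'.mp this
      rw [Matrix.smul_apply, smul_eq_mul, ← hc, mul_left_comm, hr.eq]
    obtain ⟨U₁, V₁, hU₁, hV₁, h00⟩ := hS.exists_pivot hr hrA hrA'
    obtain ⟨U₂, V₂, A', hU₂, hV₂, hB⟩ := exists_mul_mul_eq_consBlock (A := U₁ * A * V₁) (by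
      rw [h00, ← Matrix.smul_mul, ← Matrix.mul_smul, hrA'])
    rw [h00] at hB
    have hA' : IsLocallySimple A' := by
      refine isLocallySimple_of_consBlock (r := r) ?_
      rw [← hB]
      exact isLocallySimple_mul_mul (isLocallySimple_mul_mul hA hU₁ hV₁) hU₂ hV₂
    obtain ⟨U₃, V₃, q, hU₃, hV₃, hq, hqq, hs, hD⟩ := hS.exists_diagonal hA'
    have hs' : ∀ s : S, s • A = A → s * r = r ∧ s • A' = A' := fun s hsA => by
      have h1 : s • consBlock r A' = consBlock r A' := by
        rw [← hB]
        rw [← Matrix.smul_mul, ← Matrix.mul_smul, ← Matrix.smul_mul, ← Matrix.mul_smul, hsA]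
      exact ⟨congrFun (congrFun h1 0) 0,
        Matrix.ext fun i j => congrFun (congrFun h1 i.succ) j.succ⟩
    refine ⟨consBlock 1 U₃ * U₂ * U₁, V₁ * V₂ * consBlock 1 V₃, fun i => Nat.casesOn i r q,
      ((isUnit_consBlock hU₃).mul hU₂).mul hU₁, (hV₁.mul hV₂).mul (isUnit_consBlock hV₃),
      fun i => ?_, fun i => ?_, fun s hsA i => ?_, ?_⟩
    · cases i with
      | zero => exact hr
      | succ i => exact hq i
    · cases i with
      | zero => exact hs r (hs' r hrA').2 0
      | succ i => exact hqq i
    · cases i with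
      | zero => exact (hs' s hsA).1
      | succ i => exact hs s (hs' s hsA).2 i
    · have : consBlock 1 U₃ * U₂ * U₁ * A * (V₁ * V₂ * consBlock 1 V₃) =
          consBlock 1 U₃ * (U₂ * (U₁ * A * V₁) * V₂) * consBlock 1 V₃ := by
        simp only [Matrix.mul_assoc]
      rw [this, hB, consBlock_mul_consBlock, consBlock_mul_consBlock, hD, one_mul, mul_one]
      ext i j
      refine Fin.cases ?_ (fun i => ?_) i <;> refine Fin.cases ?_ (fun j => ?_) j <;>
        simp [rectDiagonal]

theorem exists_basis_eq_mulVec {W : Matrix (Fin m) (Fin m) S} (hW : IsUnit W) :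
    ∃ b : Module.Basis (Fin m) S (Fin m → S), ∀ j, b j = W.col j := by
  obtain ⟨W', h₁, h₂⟩ := isUnit_iff_exists.mp hW
  exact ⟨(Pi.basisFun S (Fin m)).map (toLin'OfInv h₂ h₁), fun j => by
    simp [toLin'OfInv]⟩

/-- From `U * A * V = D` follows `A * V = U⁻¹ * D`: the bases are the columns of `V` and of `U⁻¹`.
-/
theorem HasUnitValues.isQuasiSimple (hS : HasUnitValues S) {A : Matrix (Fin m) (Fin n) S}
    (hA : IsLocallySimple A) : IsQuasiSimple (toLin' A) := by
  obtain ⟨U, V, r, hU, hV, hr, hrr, -, hD⟩ := hS.exists_diagonal hA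
  obtain ⟨U', h₁, h₂⟩ := isUnit_iff_exists.mp hU
  obtain ⟨e, he⟩ := exists_basis_eq_mulVec hV
  obtain ⟨f, hf⟩ := exists_basis_eq_mulVec (isUnit_iff_exists.mpr ⟨U, h₂, h₁⟩)
  have hAV : A * V = U' * rectDiagonal m n r := by
    rw [← hD, Matrix.mul_assoc U, ← Matrix.mul_assoc U', h₂, Matrix.one_mul]
  have hφ : ∀ j i, toLin' A (e j) i = ∑ k, U' i k * rectDiagonal m n r k j := fun j i => by
    rw [← Matrix.mul_apply, ← hAV, he]
    rfl
  refine ⟨n, m, e, f, r, fun i _ => hr i, fun i _ => hrr i, fun i hn hm => ?_, fun i hi => ?_⟩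
  · ext k
    rw [hφ, Finset.sum_eq_single ⟨i, hm⟩]
    · simp [rectDiagonal, hf, mul_comm]
    · intro l _ hl
      rw [rectDiagonal, of_apply, if_neg (fun h => hl (Fin.ext h)), mul_zero]
    · simp
  · ext k
    rw [hφ]
    refine Finset.sum_eq_zero fun l _ => ?_
    rw [rectDiagonal, of_apply, if_neg (by have := l.2; have := i.2; omega), mul_zero]

end Diagonalization

end GenInv

theorem mainTheorem2 {R : Type*} [CommRing R] {m n : ℕ} (A : Matrix (Fin m) (Fin n) R) :
    List.TFAE [
      GenInv.IsLocallySimple A,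
      GenInv.IsLocallySimple (GenInv.extend A),
      GenInv.IsQuasiSimple (Matrix.toLin' (GenInv.extend A)),
      GenInv.AreCrossed (Matrix.toLin' (GenInv.extend A)) (Matrix.toLin' (GenInv.circ A))] := by
  tfae_have 1 → 2 := fun h => h.map _
  tfae_have 2 → 1 := GenInv.isLocallySimple_of_extend
  tfae_have 2 → 3 := (GenInv.hasUnitValues_nagataRing R).isQuasiSimple
  tfae_have 3 → 2 := fun h =>
    (GenInv.isLocallySimple_iff_exists_linearMap _).mpr h.exists_comp_comp_eq
  tfae_have 1 → 4 := GenInv.areCrossed_of_isLocallySimple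
  tfae_have 4 → 2 := fun h =>
    (GenInv.isLocallySimple_iff_exists_linearMap _).mpr h.exists_comp_comp_eq
  tfae_finish
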